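/- Let $d,l,p,q$ be positive integers, let $(a_1,\dots,a_p)$ and $(b_1,\dots,b_q)$ be partitions of $d$ (into positive integers), and let $(m_1,\dots,m_l)$ be a partition of $p+q-2>0$ into positive integers (the parts of all three may be listed in any order). Put $\lambda=(m_1,\dots,m_l)$, $\mathrm{wt}(\lambda)=\max(m_1,\dots,m_l)$, $\alpha=(a_1,\dots,a_p,-b_1,\dots,-b_q)$, and $$\deg\alpha=\frac{d}{\gcd(a_1,\dots,a_p,b_1,\dots,b_q)},$$ that is, the sum of the positive entries of $\alpha$ divided by the greatest common divisor of all its entries. If $\deg\alpha>\mathrm{wt}(\lambda)$, then there exist permutations $\tau_1,\tau_2,\sigma_1,\dots,\sigma_l$ in the symmetric group $S_d$ of $\{1,\dots,d\}$ such that 1. $\tau_1\tau_2\sigma_1\cdots\sigma_l=e$, where $e$ is the identity and permutations are multiplied from right to left; 2. $\tau_1$ has cycle type $(a_1,\dots,a_p)$, $\tau_2$ has cycle type $(b_1,\dots,b_q)$ (fixed points being counted as cycles of length $1$), and $\sigma_k$ is an $(m_k+1)$-cycle, i.e. has cycle type $(m_k+1,1,\dots,1)$ with $d-m_k-1$ ones,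 for every $k=1,\dots,l$; 3. the subgroup $\langle\tau_1,\tau_2,\sigma_1,\dots,\sigma_l\rangle$ of $S_d$ acts transitively on $\{1,\dots,d\}$. -/

import Mathlib

/-- The degree of an integer vector `α` (in practice with nonzero entries of sum zero): the sum of
its positive entries divided by the greatest common divisor of all its entries.  It is taken in
`ℚ`; for a nonzero vector the quotient is an integer. -/
def residueDegree {ι : Type*} [Fintype ι] (α : ι → ℤ) : ℚ :=
  ((∑ j with 0 < α j, α j : ℤ) : ℚ) / ((Finset.univ.gcd α : ℤ) : ℚ)

/-- The weight of a partition given by its list of parts: the largest part. -/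
def partitionWeight {l : ℕ} (m : Fin l → ℕ) : ℕ := Finset.univ.sup m

/-- The vector `(a₁, …, a_p, -b₁, …, -b_q)`. -/
def residueVector {p q : ℕ} (a : Fin p → ℕ) (b : Fin q → ℕ) : Fin p ⊕ Fin q → ℤ :=
  Sum.elim (fun i => (a i : ℤ)) (fun j => -(b j : ℤ))

/-- The permutation `τ` has cycle type `s`, where `s` lists the lengths of all cycles of `τ`,
with fixed points counted as cycles of length one. -/
def HasType {d : ℕ} (τ : Equiv.Perm (Fin d)) (s : Multiset ℕ) : Prop :=
  τ.partition.parts = s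

/-! For a single cycle the permutations are read off a plane bicoloured tree with positive edge
weights: the vertices are the cycles of `τ₁` and `τ₂`, vertex weights are cycle lengths, and the
third permutation is a cycle whose length is the number of edges, `p + q - 1`. Such a tree is built
by pruning: a vertex of smallest weight is taken as a leaf and its weight subtracted from a heavier
neighbour. Common divisors are the only obstruction (`isWeightedTree_of_forall_dvd`), and
`IsCycleRealizable.leaf` grows permutations along the tree.

Several cycles are handled by induction on their number. After possibly exchanging `a` and `b`, some
part `m` satisfies `m + 1 ≤ b.card`. Merge `m + 1` entries of `b` into one, realize the shorter
list, and factor the merged cycle into cycles of the original lengths times an `(m + 1)`-cycle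
(`IsRealizable.split`).

Both reductions must preserve a bound on common divisors (`Multiset.exists_leaf`,
`Multiset.exists_merge`). If one choice produces a bad divisor `h`, exchange an entry. A common
divisor `g` after the exchange is not a multiple of `h`, so `lcm h g ≥ 2 * g` divides almost all
entries, which makes the sum large enough. -/

namespace Equiv.Perm

/-! ### Cycle lengths and cycle types. -/

variable {α β : Type*}

/-- The number of elements of the cycle of `x` under `ρ`. -/
noncomputable def cycleLength (ρ : Perm α) (x : α) : ℕ := {y | ρ.SameCycle x y}.ncard

theorem cycleLength_eq_of_sameCycle {ρ : Perm α} {x y : α} (h : ρ.SameCycle x y) :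
    ρ.cycleLength x = ρ.cycleLength y := by
  unfold cycleLength
  congr 1
  ext z
  exact ⟨fun hz => h.symm.trans hz, fun hz => h.trans hz⟩

theorem formPerm_append_cons [DecidableEq α] (t s : List α) (u : α) :
    (t ++ u :: s).formPerm = (t ++ [u]).formPerm * (u :: s).formPerm := by
  induction t with
  | nil => simp
  | cons a t ih =>
    cases t with
    | nil => simp
    | cons b t =>
      simp only [List.cons_append, List.formPerm_cons_cons] at ih ⊢
      rw [ih, mul_assoc]

theorem cycleLength_eq_length {ρ : Perm α} {u : α} {l : List α} (hl : l.Nodup)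
    (h : ∀ x, x ∈ l ↔ ρ.SameCycle u x) : ρ.cycleLength u = l.length := by
  classical
  rw [← List.toFinset_card_of_nodup hl, ← Set.ncard_coe_finset]
  unfold cycleLength
  congr 1
  ext x
  simp [h]

/-- `P` and `P ∘ f` hold at equally many points because `f` is a bijection of a finite type, so they
cannot differ at exactly one point. -/
theorem apply_iff_of_forall_ne [Fintype α] {f : Perm α} {P : α → Prop} {u : α}
    (h : ∀ x, x ≠ u → (P (f x) ↔ P x)) : P (f u) ↔ P u := by
  classical
  have hc : (Finset.univ.filter fun x => P (f x)).card = (Finset.univ.filter P).card :=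
    Finset.card_bij (fun x _ => f x) (by simp) (fun _ _ _ _ h => f.injective h)
      fun y hy => ⟨f.symm y, by simpa using hy, by simp⟩
  by_contra hne
  have hsub : ∀ Q Q' : α → Prop, (∀ x, x ≠ u → (Q x ↔ Q' x)) → Q u → ¬ Q' u →
      (Finset.univ.filter Q').card < (Finset.univ.filter Q).card := by
    intro Q Q' hQ hu hu'
    apply Finset.card_lt_card
    refine ⟨fun x hx => ?_, fun hh => ?_⟩
    · simp only [Finset.mem_filter, Finset.mem_univ, true_and] at hx ⊢
      exact (hQ x (fun e => hu' (e ▸ hx))).2 hx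
    · have := hh (show u ∈ Finset.univ.filter Q by simpa using hu)
      exact hu' (by simpa using this)
  by_cases hu : P u
  · have := hsub P (fun x => P (f x)) (fun x hx => (h x hx).symm) hu (by tauto)
    omega
  · have := hsub (fun x => P (f x)) P h (by tauto) hu
    omega

theorem sameCycle_sumCongr_inl {σ : Perm α} {τ : Perm β} {x : α} {y : α ⊕ β} :
    (sumCongr σ τ).SameCycle (Sum.inl x) y ↔ ∃ z, y = Sum.inl z ∧ σ.SameCycle x z := by
  have h : ∀ i : ℤ, ((sumCongr σ τ) ^ i) (Sum.inl x) = Sum.inl ((σ ^ i) x) := by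
    intro i
    have : (sumCongr σ τ) ^ i = sumCongr (σ ^ i) (τ ^ i) := by
      have := (map_zpow (sumCongrHom α β) (σ, τ) i).symm
      simpa using this
    rw [this]; rfl
  constructor
  · rintro ⟨i, rfl⟩; exact ⟨_, h i, i, rfl⟩
  · rintro ⟨z, rfl, i, rfl⟩; exact ⟨i, h i⟩

theorem cycleLength_sumCongr_inl (σ : Perm α) (τ : Perm β) (x : α) :
    (sumCongr σ τ).cycleLength (Sum.inl x) = σ.cycleLength x := by
  unfold cycleLength
  rw [← Set.ncard_image_of_injective _ (Sum.inl_injective (α := α) (β := β))]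
  congr 1
  ext y
  simp only [Set.mem_ofPred_eq, sameCycle_sumCongr_inl, Set.mem_image]
  exact exists_congr fun z => ⟨fun h => ⟨h.2, h.1.symm⟩, fun h => ⟨h.2.symm, h.1⟩⟩

theorem cycleLength_sumCongr_inr (σ : Perm α) (τ : Perm β) (x : β) :
    (sumCongr σ τ).cycleLength (Sum.inr x) = τ.cycleLength x := by
  have h : ∀ i : ℤ, ((sumCongr σ τ) ^ i) (Sum.inr x) = Sum.inr ((τ ^ i) x) := by
    intro i
    have : (sumCongr σ τ) ^ i = sumCongr (σ ^ i) (τ ^ i) := by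
      simpa using (map_zpow (sumCongrHom α β) (σ, τ) i).symm
    rw [this]; rfl
  unfold cycleLength
  rw [← _root_.Set.ncard_image_of_injective _ (Sum.inr_injective (α := α) (β := β))]
  congr 1
  ext y
  constructor
  · rintro ⟨i, rfl⟩; exact ⟨_, ⟨i, rfl⟩, (h i).symm⟩
  · rintro ⟨z, ⟨i, rfl⟩, rfl⟩; exact ⟨i, h i⟩

variable [Fintype α] [DecidableEq α] [Fintype β] [DecidableEq β]

theorem exists_list_formPerm_eq_cycleOf (ρ : Perm α) (u : α) :
    ∃ t : List α, (u :: t).Nodup ∧ (∀ x, x ∈ u :: t ↔ ρ.SameCycle u x) ∧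
      (u :: t).formPerm = ρ.cycleOf u := by
  by_cases h : u ∈ ρ.support
  · have hne : 0 < (toList ρ u).length := length_toList_pos_of_mem_support _ _ h
    have h0 := toList_getElem_zero (p := ρ) (x := u) h
    obtain ⟨a, t, hat⟩ := List.exists_cons_of_length_pos hne
    have ha : a = u := by simpa [hat] using h0
    subst ha
    refine ⟨t, hat ▸ nodup_toList ρ a, fun x => ?_, hat ▸ formPerm_toList ρ a⟩
    rw [← hat, mem_toList_iff]
    exact and_iff_left h
  · have hu : ρ u = u := by simpa using h
    refine ⟨[], by simp, fun x => ?_, ?_⟩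
    · simp only [List.mem_singleton]
      constructor
      · rintro rfl; exact SameCycle.refl _ _
      · intro hx; exact ((hx.eq_of_left hu)).symm
    · rw [List.formPerm_singleton, eq_comm, cycleOf_eq_one_iff]; exact hu

/-- `R` fixes every point of `l`, so the factor `l.formPerm` trades `l.length` fixed points for one
cycle. Putting the ones on the left avoids subtraction and covers lists of length one. -/
theorem parts_formPerm_mul {l : List α} (hl : l.Nodup) (hne : l ≠ []) {R : Perm α}
    (hR : ∀ x ∈ l, R x = x) :
    (l.formPerm * R).partition.parts + Multiset.replicate l.length 1
      = l.length ::ₘ R.partition.parts := by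
  rcases Nat.lt_or_ge l.length 2 with h | h
  · have h1 : l.length = 1 := by
      have := List.length_pos_iff.2 hne; omega
    obtain ⟨a, rfl⟩ := List.length_eq_one_iff.1 h1
    simp [add_comm]
  · have hdisj : Disjoint l.formPerm R := by
      intro x
      by_cases hx : x ∈ l
      · exact Or.inr (hR x hx)
      · exact Or.inl (List.formPerm_apply_of_notMem hx)
    have hc : (l.formPerm).cycleType = {l.length} := by
      have hcyc := List.isCycle_formPerm hl h
      rw [hcyc.cycleType, List.support_formPerm_of_nodup l hl, List.toFinset_card_of_nodup hl]
      rintro x rfl; simp at h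
    have hs := hdisj.card_support_mul
    have hn := Finset.card_le_univ (l.formPerm * R).support
    have hls : l.formPerm.support.card = l.length := by
      rw [← sum_cycleType, hc]; simp
    rw [parts_partition, parts_partition, hdisj.cycleType_mul, hc, hs, hls]
    rw [hs, hls] at hn
    have : Fintype.card α - R.support.card
        = (Fintype.card α - (l.length + R.support.card)) + l.length := by omega
    rw [this, Multiset.replicate_add, Multiset.singleton_add, Multiset.cons_add, Multiset.cons_add,
      add_assoc]

theorem exists_cycleLength_eq {ρ : Perm α} {k : ℕ} (hk : k ∈ ρ.partition.parts) :
    ∃ u, ρ.cycleLength u = k := by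
  rw [parts_partition, Multiset.mem_add] at hk
  rcases hk with hk | hk
  · rw [cycleType_def, Multiset.mem_map] at hk
    obtain ⟨c, hc, rfl⟩ := hk
    have hc' : c ∈ ρ.cycleFactorsFinset := hc
    obtain ⟨u, hu⟩ := (mem_cycleFactorsFinset_iff.1 hc').1.nonempty_support
    refine ⟨u, ?_⟩
    have hcu := cycle_is_cycleOf hu hc'
    unfold cycleLength
    rw [Function.comp_apply, ← Set.ncard_coe_finset]
    congr 1
    ext y
    have hus : u ∈ ρ.support := mem_cycleFactorsFinset_support_le hc' hu
    rw [hcu]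
    simp only [Set.mem_ofPred_eq, Finset.mem_coe, mem_support_cycleOf_iff]
    exact (and_iff_left hus).symm
  · obtain ⟨hne, rfl⟩ := Multiset.mem_replicate.1 hk
    have : ρ.support ≠ Finset.univ := by
      intro h; rw [h, Finset.card_univ] at hne; simp at hne
    obtain ⟨u, hu⟩ : ∃ u, u ∉ ρ.support := by
      by_contra! h; exact this (Finset.eq_univ_iff_forall.2 h)
    have hu : ρ u = u := by simpa using hu
    refine ⟨u, cycleLength_eq_length (l := [u]) (by simp) fun x => ?_⟩
    simp only [List.mem_singleton]
    constructor
    · rintro rfl; exact SameCycle.refl _ _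
    · intro hx; exact ((hx.eq_of_left hu)).symm

theorem cycleLength_mem_parts (ρ : Perm α) (u : α) : ρ.cycleLength u ∈ ρ.partition.parts := by
  obtain ⟨t, hn, hm, hf⟩ := exists_list_formPerm_eq_cycleOf ρ u
  rw [cycleLength_eq_length hn hm]
  have hR : ∀ x ∈ u :: t, ((u :: t).formPerm⁻¹ * ρ) x = x := by
    intro x hx
    rw [hf, mul_apply, inv_eq_iff_eq, ((hm x).1 hx).cycleOf_apply]
  have := parts_formPerm_mul hn (by simp) hR
  rw [mul_inv_cancel_left] at this
  by_cases h1 : (u :: t).length = 1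
  · rw [h1, Multiset.replicate_one] at this
    have ht : t = [] := by simpa using h1
    subst ht
    have hu : ρ u = u := by
      have := hR u (by simp); simpa using this
    rw [h1, parts_partition, Multiset.mem_add]
    right
    rw [Multiset.mem_replicate]
    have : ρ.support.card < Fintype.card α := by
      rw [← Finset.card_univ]
      apply Finset.card_lt_card
      rw [Finset.ssubset_univ_iff]
      intro h
      have := Finset.mem_univ u
      rw [← h] at this
      simp [hu] at this
    exact ⟨by omega, rfl⟩
  · have hmem : (u :: t).length ∈ ρ.partition.parts + Multiset.replicate (u :: t).length 1 := by
      rw [this]; exact Multiset.mem_cons_self _ _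
    rcases Multiset.mem_add.1 hmem with h | h
    · exact h
    · exact absurd (Multiset.eq_of_mem_replicate h) h1

/-- List the cycle of `u` so that it ends in `u`, and that of `v` so that it starts with `ρ v`. As
`ρ * swap u v` sends `u` to `ρ v`, its new cycle is the concatenation of the two lists. -/
theorem parts_mul_swap {ρ : Perm α} {u v : α} (huv : ¬ ρ.SameCycle u v) :
    (ρ * swap u v).partition.parts + {ρ.cycleLength u, ρ.cycleLength v}
      = ρ.partition.parts + {ρ.cycleLength u + ρ.cycleLength v} := by
  obtain ⟨s, hsn, hsm, hsf⟩ := exists_list_formPerm_eq_cycleOf ρ u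
  obtain ⟨t, htn, htm, htf⟩ := exists_list_formPerm_eq_cycleOf ρ (ρ v)
  have hvv : ρ.SameCycle (ρ v) v := sameCycle_apply_left.2 (SameCycle.refl _ _)
  have hsn' : (s ++ [u]).Nodup := by
    rw [List.nodup_append_comm]; exact hsn
  have hsm' : ∀ x, x ∈ s ++ [u] ↔ ρ.SameCycle u x := by
    intro x; rw [← hsm x]; simp [or_comm]
  have hsf' : (s ++ [u]).formPerm = ρ.cycleOf u := by
    rw [← hsf, ← List.formPerm_rotate_one _ hsn]; simp
  rw [cycleLength_eq_length hsn' hsm', ← cycleLength_eq_of_sameCycle hvv,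
    cycleLength_eq_length htn htm]
  set l₁ := s ++ [u] with hl₁
  set l₂ := ρ v :: t with hl₂
  have hdis : ∀ x, x ∈ l₁ → x ∈ l₂ → False := fun x h1 h2 =>
    huv (((hsm' x).1 h1).trans ((((htm x).1 h2).symm).trans hvv))
  have hn : (l₁ ++ l₂).Nodup :=
    List.nodup_append.2 ⟨hsn', htn, fun a ha b hb hab => hdis a ha (hab ▸ hb)⟩
  set Q : Perm α := l₁.formPerm⁻¹ * ρ with hQ
  set R : Perm α := l₂.formPerm⁻¹ * Q with hRdef
  have hQ1 : ∀ x ∈ l₁, Q x = x := by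
    intro x hx
    rw [hQ, hsf', mul_apply, inv_eq_iff_eq, ((hsm' x).1 hx).cycleOf_apply]
  have hQ2 : ∀ x ∈ l₂, Q x = ρ x := by
    intro x hx
    rw [hQ, mul_apply, inv_eq_iff_eq, List.formPerm_apply_of_notMem]
    intro h
    refine hdis x ?_ hx
    rw [hsm'] at h ⊢
    exact sameCycle_apply_right.1 h
  have hR2 : ∀ x ∈ l₂, R x = x := by
    intro x hx
    rw [hRdef, mul_apply, inv_eq_iff_eq, hQ2 x hx, htf, ((htm x).1 hx).cycleOf_apply]
  have hR1 : ∀ x ∈ l₁, R x = x := by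
    intro x hx
    rw [hRdef, mul_apply, inv_eq_iff_eq, hQ1 x hx, List.formPerm_apply_of_notMem fun h => hdis x hx h]
  have e1 := parts_formPerm_mul hsn' (by simp [hl₁]) hQ1
  have e2 := parts_formPerm_mul htn (by simp) hR2
  have e3 := parts_formPerm_mul (R := R) hn (by simp [hl₁]) (by
    intro x hx
    rcases List.mem_append.1 hx with h | h
    · exact hR1 x h
    · exact hR2 x h)
  have hprod : ρ * swap u v = (l₁ ++ l₂).formPerm * R := by
    have hfl : (l₁ ++ l₂).formPerm = l₁.formPerm * (swap u (ρ v) * l₂.formPerm) := by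
      rw [hl₁, List.append_assoc, List.singleton_append, formPerm_append_cons, hl₂,
        List.formPerm_cons_cons]
    have hρ : ρ = l₁.formPerm * Q := by rw [hQ, mul_inv_cancel_left]
    have hsw : Q * swap u v = swap u (ρ v) * Q := by
      rw [mul_swap_eq_swap_mul, hQ1 u (by simp [hl₁]), hQ2 v ((htm v).2 hvv)]
    calc ρ * swap u v = l₁.formPerm * (Q * swap u v) := by
          rw [← mul_assoc, ← hρ]
      _ = l₁.formPerm * (swap u (ρ v) * (l₂.formPerm * R)) := by
          rw [hsw, hRdef, mul_inv_cancel_left]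
      _ = _ := by rw [hfl]; simp only [mul_assoc]
  rw [hQ, mul_inv_cancel_left] at e1
  rw [hRdef, mul_inv_cancel_left] at e2
  rw [← hprod, List.length_append, Multiset.replicate_add, hRdef] at e3
  have key : (ρ * swap u v).partition.parts + {l₁.length, l₂.length}
      + (Multiset.replicate l₁.length 1 + Multiset.replicate l₂.length 1)
      = ρ.partition.parts + {l₁.length + l₂.length}
      + (Multiset.replicate l₁.length 1 + Multiset.replicate l₂.length 1) := by
    have p2 : ({l₁.length, l₂.length} : Multiset ℕ) = {l₁.length} + {l₂.length} := rfl
    rw [← Multiset.singleton_add] at e1 e2 e3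
    rw [p2]
    calc _ = ((ρ * swap u v).partition.parts
          + (Multiset.replicate l₁.length 1 + Multiset.replicate l₂.length 1))
          + ({l₁.length} + {l₂.length}) := by abel
      _ = {l₁.length + l₂.length} + {l₁.length}
          + ({l₂.length} + (l₂.formPerm⁻¹ * Q).partition.parts) := by rw [e3]; abel
      _ = {l₁.length + l₂.length} + ({l₁.length} + Q.partition.parts)
          + Multiset.replicate l₂.length 1 := by rw [← e2]; abel
      _ = _ := by rw [← e1]; abel
  exact add_right_cancel key

theorem parts_swap_mul {ρ : Perm α} {u v : α} (huv : ¬ ρ.SameCycle u v) :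
    (swap u v * ρ).partition.parts + {ρ.cycleLength u, ρ.cycleLength v}
      = ρ.partition.parts + {ρ.cycleLength u + ρ.cycleLength v} := by
  rw [← parts_mul_swap huv]
  have : (swap u v * ρ).partition = (ρ * swap u v).partition := by
    rw [← partition_eq_of_isConj, isConj_iff]
    exact ⟨swap u v, by simp [← mul_assoc]⟩
  rw [this]

theorem parts_inv (σ : Perm α) : σ⁻¹.partition.parts = σ.partition.parts := by
  rw [parts_partition, parts_partition, cycleType_inv, support_inv]

theorem parts_one : (1 : Perm α).partition.parts = Multiset.replicate (Fintype.card α) 1 := by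
  simp [parts_partition]

theorem parts_permCongr (e : α ≃ β) (σ : Perm α) :
    (e.permCongr σ).partition.parts = σ.partition.parts := by
  have h : (e.permCongr σ).cycleType = σ.cycleType := by
    have := cycleType_extendDomain (p := fun _ : β => True)
      (f := e.trans (Equiv.Set.univ β).symm) (g := σ)
    rw [← this]
    congr 1
  rw [parts_partition, parts_partition, h, ← sum_cycleType, ← sum_cycleType, h,
    Fintype.card_congr e]

theorem cycleType_sumCongr (σ : Perm α) (τ : Perm β) :
    (sumCongr σ τ).cycleType = σ.cycleType + τ.cycleType := by
  have h1 : (sumCongr σ (1 : Perm β)).cycleType = σ.cycleType := by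
    have := cycleType_extendDomain (f := Equiv.ofInjective (Sum.inl : α → α ⊕ β) Sum.inl_injective)
      (g := σ)
    rw [← this]
    congr 1
    refine Equiv.ext fun x => ?_
    rcases x with x | x
    · exact (extendDomain_apply_image σ (Equiv.ofInjective Sum.inl Sum.inl_injective) x).symm
    · exact (extendDomain_apply_not_subtype σ _ (by simp)).symm
  have h2 : (sumCongr (1 : Perm α) τ).cycleType = τ.cycleType := by
    have := cycleType_extendDomain (f := Equiv.ofInjective (Sum.inr : β → α ⊕ β) Sum.inr_injective)
      (g := τ)
    rw [← this]
    congr 1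
    refine Equiv.ext fun x => ?_
    rcases x with x | x
    · exact (extendDomain_apply_not_subtype τ _ (by simp)).symm
    · exact (extendDomain_apply_image τ (Equiv.ofInjective Sum.inr Sum.inr_injective) x).symm
  have hd : Disjoint (sumCongr σ (1 : Perm β)) (sumCongr (1 : Perm α) τ) := by
    rintro (x | x) <;> simp
  have hm : sumCongr σ τ = sumCongr σ (1 : Perm β) * sumCongr (1 : Perm α) τ := by
    ext x; rcases x with x | x <;> simp
  rw [hm, hd.cycleType_mul, h1, h2]

theorem parts_sumCongr (σ : Perm α) (τ : Perm β) :
    (sumCongr σ τ).partition.parts = σ.partition.parts + τ.partition.parts := by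
  have h := cycleType_sumCongr σ τ
  have h1 := Finset.card_le_univ σ.support
  have h2 := Finset.card_le_univ τ.support
  rw [parts_partition, parts_partition, parts_partition, h, ← sum_cycleType (sumCongr σ τ), h,
    Multiset.sum_add, sum_cycleType, sum_cycleType, Fintype.card_sum,
    show Fintype.card α + Fintype.card β - (σ.support.card + τ.support.card)
      = (Fintype.card α - σ.support.card) + (Fintype.card β - τ.support.card) by omega,
    Multiset.replicate_add]
  abel

theorem parts_finRotate {n : ℕ} (hn : 0 < n) : (finRotate n).partition.parts = {n} := by
  rcases Nat.lt_or_ge n 2 with h | h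
  · obtain rfl : n = 1 := by omega
    have : finRotate 1 = 1 := Subsingleton.elim _ _
    simp [this, parts_one]
  · rw [parts_partition, cycleType_finRotate_of_le h, support_finRotate_of_le h]
    simp

theorem sum_parts (σ : Perm α) : σ.partition.parts.sum = Fintype.card α :=
  σ.partition.parts_sum

theorem exists_permCongr_eq {σ : Perm α} {τ : Perm β} (h : σ.partition.parts = τ.partition.parts) :
    ∃ e : α ≃ β, e.permCongr σ = τ := by
  have hc : Fintype.card α = Fintype.card β := by rw [← sum_parts σ, h, sum_parts]
  let e := Fintype.equivOfCardEq hc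
  have : (e.permCongr σ).partition = τ.partition := by
    ext1; rw [parts_permCongr, h]
  rw [← partition_eq_of_isConj, isConj_iff] at this
  obtain ⟨c, hc⟩ := this
  refine ⟨e.trans c, ?_⟩
  rw [← hc]
  ext x
  simp [Equiv.permCongr_apply]

theorem exists_perm_parts (s : Multiset ℕ) (hs : ∀ x ∈ s, 0 < x) :
    ∃ (γ : Type) (_ : Fintype γ) (_ : DecidableEq γ) (τ : Perm γ), τ.partition.parts = s := by
  induction s using Multiset.induction with
  | empty => exact ⟨Fin 0, inferInstance, inferInstance, 1, by simp [parts_partition]⟩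
  | cons a s ih =>
    obtain ⟨γ, _, _, τ, hτ⟩ := ih fun x hx => hs x (Multiset.mem_cons_of_mem hx)
    refine ⟨Fin a ⊕ γ, inferInstance, inferInstance, sumCongr (finRotate a) τ, ?_⟩
    rw [parts_sumCongr, parts_finRotate (hs a (Multiset.mem_cons_self _ _)), hτ,
      Multiset.singleton_add]

end Equiv.Perm

/-! ### Merging entries under control of common divisors. -/

theorem Multiset.mul_card_le_sum {s : Multiset ℕ} {n : ℕ} (hpos : ∀ x ∈ s, 0 < x)
    (hn : ∀ x ∈ s, n ∣ x) : n * s.card ≤ s.sum := by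
  have := Multiset.card_nsmul_le_sum (s := s) (a := n) fun x hx => Nat.le_of_dvd (hpos x hx) (hn x hx)
  rwa [smul_eq_mul, mul_comm] at this

theorem Nat.two_mul_le_lcm {m n : ℕ} (hm : 0 < m) (hn : 0 < n) (h : ¬ m ∣ n) :
    2 * n ≤ m.lcm n := by
  obtain ⟨c, hc⟩ := Nat.dvd_lcm_right m n
  have hpos : 0 < m.lcm n := Nat.lcm_pos hm hn
  have h0 : c ≠ 0 := by rintro rfl; omega
  have h1 : c ≠ 1 := by
    rintro rfl
    apply h
    have := Nat.dvd_lcm_left m n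
    rwa [hc, mul_one] at this
  rw [hc, mul_comm]
  exact Nat.mul_le_mul_left _ (by omega)

/-- Among the ways of replacing `m + 1` elements of `b` by their sum, one creates no large common
divisor. -/
theorem Multiset.exists_merge {a b : Multiset ℕ} (ha : ∀ x ∈ a, 0 < x) (hb : ∀ x ∈ b, 0 < x)
    (hsum : a.sum = b.sum) (hpos : 0 < a.sum) {m : ℕ} (hm : m + 1 ≤ b.card) {K : Set ℕ}
    (hK : ∀ k ∈ K, k + m + 2 ≤ a.card + b.card)
    (hgood : ∀ k ∈ K, ∀ h, (∀ x ∈ a, h ∣ x) → (∀ x ∈ b, h ∣ x) → h * k < a.sum) :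
    ∃ B U : Multiset ℕ, b = B + U ∧ B.card = m + 1 ∧
      ∀ k ∈ K, ∀ h, (∀ x ∈ a, h ∣ x) → (∀ x ∈ B.sum ::ₘ U, h ∣ x) → h * k < a.sum := by
  obtain ⟨B, U, rfl, hBc⟩ : ∃ B U : Multiset ℕ, b = B + U ∧ B.card = m + 1 := by
    induction b using Quotient.inductionOn with | _ l =>
    refine ⟨l.take (m + 1), l.drop (m + 1), ?_, ?_⟩
    · exact congrArg _ (List.take_append_drop (m + 1) l).symm
    · simpa using hm
  by_cases hall : ∀ k ∈ K, ∀ h, (∀ x ∈ a, h ∣ x) → (∀ x ∈ B.sum ::ₘ U, h ∣ x) → h * k < a.sum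
  · exact ⟨B, U, rfl, hBc, hall⟩
  push Not at hall
  obtain ⟨k, hkK, h, hha, hhU, hle⟩ := hall
  have hh0 : 0 < h := by
    rcases Nat.eq_zero_or_pos h with rfl | h'
    · omega
    · exact h'
  have hUc : ∀ k ∈ K, k + 1 ≤ a.card + U.card := by
    intro k hk
    have := hK k hk
    rw [Multiset.card_add] at this; omega
  -- Otherwise `h` would divide all the original entries, against `hgood`.
  obtain ⟨y, hyB, hy⟩ : ∃ y ∈ B, ¬ h ∣ y := by
    by_contra! hc
    refine absurd (hgood k hkK h hha fun x hx => ?_) (by omega)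
    rcases Multiset.mem_add.1 hx with hx | hx
    · exact hc x hx
    · exact hhU x (Multiset.mem_cons_of_mem hx)
  obtain ⟨B₁, rfl⟩ := Multiset.exists_cons_of_mem hyB
  -- If `U` is empty then `k < a.card`, while `h * a.card ≤ a.sum ≤ h * k`.
  rcases U.empty_or_exists_mem with rfl | ⟨z, hz⟩
  · have h1 := Multiset.mul_card_le_sum ha hha
    have h2 : h * k < h * a.card := by
      apply Nat.mul_lt_mul_of_pos_left _ hh0
      have := hUc k hkK
      simp at this; omega
    omega
  obtain ⟨V, rfl⟩ := Multiset.exists_cons_of_mem hz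
  have hbV : ∀ x ∈ V, 0 < x := fun x hx => hb x (by simp [hx])
  have hby : 0 < y := hb y (by simp)
  have hbz : 0 < z := hb z (by simp)
  -- Exchange `y` and `z`: now `y` stays unmerged, so a new common divisor `g` divides `y` and
  -- cannot be a multiple of `h`.
  refine ⟨z ::ₘ B₁, y ::ₘ V, ?_, by simpa using hBc, ?_⟩
  · simp only [Multiset.cons_add, Multiset.add_cons]
    rw [Multiset.cons_swap]
  intro k' hk' g hga hgU
  have hgy : g ∣ y := hgU y (by simp)
  have hg0 : 0 < g := Nat.pos_of_dvd_of_pos hgy hby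
  have hL := Nat.two_mul_le_lcm hh0 hg0 fun hd => hy (hd.trans hgy)
  have h1 := Multiset.mul_card_le_sum ha (n := h.lcm g) fun x hx => Nat.lcm_dvd (hha x hx) (hga x hx)
  have h2 := Multiset.mul_card_le_sum hbV (n := h.lcm g) fun x hx =>
    Nat.lcm_dvd (hhU x (by simp [hx])) (hgU x (by simp [hx]))
  have h3 : g ≤ y := Nat.le_of_dvd hby hgy
  have h4 : g ≤ (z ::ₘ B₁).sum := Nat.le_of_dvd (by simp; omega) (hgU _ (by simp))
  have h5 : a.sum = y + (z ::ₘ B₁).sum + V.sum := by rw [hsum]; simp; ring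
  have h6 := hUc k' hk'
  rw [Multiset.card_cons] at h6
  have h7 : 2 * g * a.card ≤ a.sum := le_trans (Nat.mul_le_mul_right _ hL) h1
  have h8 : 2 * g * V.card ≤ V.sum := le_trans (Nat.mul_le_mul_right _ hL) h2
  -- Adding `h7`, `h8` and the two entries of size at least `g` gives `a.sum ≥ g * (a.card + V.card
  -- + 1)`, which exceeds `g * k'`.
  nlinarith

/-! ### Existence of weighted trees. -/

/-- The pairs of multisets of weighted degrees of the two colour classes in a plane bicoloured tree
with positive edge weights. -/
inductive IsWeightedTree : Multiset ℕ → Multiset ℕ → Prop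
  | edge {w : ℕ} (hw : 0 < w) : IsWeightedTree {w} {w}
  | leaf {a b : Multiset ℕ} {w y : ℕ} (hw : 0 < w) (h : IsWeightedTree a (y ::ₘ b)) :
      IsWeightedTree (w ::ₘ a) ((y + w) ::ₘ b)
  | symm {a b : Multiset ℕ} (h : IsWeightedTree a b) : IsWeightedTree b a

/-- Pruning a leaf of minimal weight `s`: `s` is subtracted from an entry of `b` larger than `s`. If
the first candidate creates a bad divisor `h`, then `h ∤ s`, so every other entry of `b`, being a
multiple of `h`, exceeds `s` and can be used instead. -/
theorem Multiset.exists_leaf {a b : Multiset ℕ} {s : ℕ} (hs : 0 < s)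
    (ha : ∀ x ∈ a, s ≤ x) (hb : ∀ x ∈ b, s ≤ x) (hsum : s + a.sum = b.sum)
    (hx : ∃ x ∈ b, s < x)
    (hgood : ∀ h, h ∣ s → (∀ x ∈ a, h ∣ x) → (∀ x ∈ b, h ∣ x) →
      h * (a.card + 1 + b.card) < s + a.sum + 2 * h) :
    ∃ y c, 0 < y ∧ b = (y + s) ::ₘ c ∧
      ∀ h, (∀ x ∈ a, h ∣ x) → (∀ x ∈ y ::ₘ c, h ∣ x) → h * (a.card + b.card) < a.sum + 2 * h := by
  obtain ⟨x, hxb, hsx⟩ := hx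
  obtain ⟨c, rfl⟩ := Multiset.exists_cons_of_mem hxb
  obtain ⟨y, rfl⟩ := Nat.exists_eq_add_of_lt hsx
  have hap : ∀ x ∈ a, 0 < x := fun x hx => hs.trans_le (ha x hx)
  have hcp : ∀ x ∈ c, 0 < x := fun x hx => hs.trans_le (hb x (by simp [hx]))
  have hS : a.sum = (y + 1) + c.sum := by simp at hsum; omega
  have hPs : s * a.card ≤ a.sum := by
    have := Multiset.card_nsmul_le_sum ha; rwa [smul_eq_mul, mul_comm] at this
  have hQs : s * c.card ≤ c.sum := by
    have := Multiset.card_nsmul_le_sum (s := c) (a := s) fun x hx => hb x (by simp [hx])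
    rwa [smul_eq_mul, mul_comm] at this
  by_cases hall : ∀ h, (∀ x ∈ a, h ∣ x) → (∀ x ∈ (y + 1) ::ₘ c, h ∣ x) →
      h * (a.card + (c.card + 1)) < a.sum + 2 * h
  · exact ⟨y + 1, c, by omega, by congr 1; omega, by simpa using hall⟩
  push Not at hall
  obtain ⟨h, hha, hhc, hle⟩ := hall
  have hhy : h ∣ y + 1 := hhc _ (by simp)
  have hh0 : 0 < h := Nat.pos_of_dvd_of_pos hhy (by omega)
  have hPh := Multiset.mul_card_le_sum hap hha
  have hns : ¬ h ∣ s := by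
    rintro ⟨t, rfl⟩
    have hg := hgood h (by simp) hha (fun x hx => by
      rcases Multiset.mem_cons.1 hx with rfl | hx
      · rw [add_assoc]; exact (dvd_mul_right _ _).add hhy
      · exact hhc x (by simp [hx]))
    rw [Multiset.card_cons] at hg
    -- For `s = h` the bound is `hgood` itself; for `s ≥ 2 * h` minimality of `s` makes all entries
    -- at least `2 * h`, and the sum is too large.
    rcases Nat.lt_or_ge t 2 with ht | ht
    · obtain rfl : t = 1 := by
        rcases Nat.eq_zero_or_pos t with rfl | h' <;> omega
      nlinarith
    · have e1 : 2 * h * a.card ≤ a.sum := le_trans (Nat.mul_le_mul_right _ (by nlinarith)) hPs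
      have e2 : 2 * h * c.card ≤ c.sum := le_trans (Nat.mul_le_mul_right _ (by nlinarith)) hQs
      nlinarith
  rcases c.empty_or_exists_mem with rfl | ⟨x, hxc⟩
  · simp at hle; nlinarith
  obtain ⟨e, rfl⟩ := Multiset.exists_cons_of_mem hxc
  have hhx : h ∣ x := hhc x (by simp)
  have hsx2 : s < x := lt_of_le_of_ne (hb x (by simp)) (by rintro rfl; exact hns hhx)
  obtain ⟨z, rfl⟩ := Nat.exists_eq_add_of_lt hsx2
  refine ⟨z + 1, (s + y + 1) ::ₘ e, by omega, ?_, ?_⟩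
  · rw [Multiset.cons_swap]; congr 1; omega
  intro g hga hgc
  have hgz : g ∣ z + 1 := hgc _ (by simp)
  have hg0 : 0 < g := Nat.pos_of_dvd_of_pos hgz (by omega)
  -- If `h ∣ g`, then `h` divides both `z + 1` and `s + z + 1`, hence `s`.
  have hL := Nat.two_mul_le_lcm hh0 hg0 (by
    intro hd
    apply hns
    have := hd.trans hgz
    rw [add_assoc] at hhx
    exact (Nat.dvd_add_left this).1 hhx)
  have h1 := Multiset.mul_card_le_sum hap (n := h.lcm g) fun x hx =>
    Nat.lcm_dvd (hha x hx) (hga x hx)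
  have h2 := Multiset.mul_card_le_sum (s := e) (n := h.lcm g) (fun x hx => hcp x (by simp [hx]))
    fun x hx => Nat.lcm_dvd (hhc x (by simp [hx])) (hgc x (by simp [hx]))
  have h7 : 2 * g * a.card ≤ a.sum := le_trans (Nat.mul_le_mul_right _ hL) h1
  have h8 : 2 * g * e.card ≤ e.sum := le_trans (Nat.mul_le_mul_right _ hL) h2
  have h3 : g ≤ s + y + 1 := Nat.le_of_dvd (by omega) (hgc _ (by simp))
  have h4 : g ≤ z + 1 := Nat.le_of_dvd (by omega) hgz
  simp only [Multiset.card_cons, Multiset.sum_cons] at hS ⊢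
  nlinarith

/-- `hgood` is also necessary: `h` divides every edge weight, by pruning leaves, and there are
`a.card + b.card - 1` edges. -/
theorem isWeightedTree_of_forall_dvd {a b : Multiset ℕ} (ha : ∀ x ∈ a, 0 < x)
    (hb : ∀ x ∈ b, 0 < x) (hsum : a.sum = b.sum) (hpos : 0 < a.sum)
    (hgood : ∀ h, (∀ x ∈ a, h ∣ x) → (∀ x ∈ b, h ∣ x) →
      h * (a.card + b.card) < a.sum + 2 * h) : IsWeightedTree a b := by
  induction hn : a.card + b.card using Nat.strong_induction_on generalizing a b with
  | _ n ih =>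
  -- one reduction step, for a smallest element `s` lying in the first multiset
  have step : ∀ {a b : Multiset ℕ} {s : ℕ}, a.card + b.card = n → (∀ x ∈ a, s ≤ x) →
      (∀ x ∈ b, s ≤ x) → 0 < s → s ∈ a → a.sum = b.sum → (∃ x ∈ b, s < x) →
      (∀ h, (∀ x ∈ a, h ∣ x) → (∀ x ∈ b, h ∣ x) →
        h * (a.card + b.card) < a.sum + 2 * h) → IsWeightedTree a b := by
    intro a b s hn ha hb hs hsa hsum hx hgood
    obtain ⟨a, rfl⟩ := Multiset.exists_cons_of_mem hsa
    obtain ⟨y, c, hy, rfl, hred⟩ := Multiset.exists_leaf (a := a) hs (fun x hx => ha x (by simp [hx])) hb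
      (by simpa using hsum) hx (fun h h1 h2 h3 => by
        have := hgood h (fun x hx => by
          rcases Multiset.mem_cons.1 hx with rfl | hx
          · exact h1
          · exact h2 x hx) h3
        simpa using this)
    have hs' : a.sum = (y ::ₘ c).sum := by simp at hsum ⊢; omega
    refine .leaf hs (ih (a.card + (y ::ₘ c).card) ?_ ?_ ?_ hs' ?_ ?_ rfl)
    · simp at hn ⊢; omega
    · exact fun x hx => hs.trans_le (ha x (by simp [hx]))
    · intro x hx
      rcases Multiset.mem_cons.1 hx with rfl | hx
      · exact hy
      · exact hs.trans_le (hb x (by simp [hx]))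
    · rw [hs']; simp; omega
    · simpa using hred
  obtain ⟨s, hsab, hmin⟩ : ∃ s ∈ a + b, ∀ x ∈ a + b, s ≤ x := by
    have hne : ∃ x, x ∈ a + b := by
      by_contra! h
      have : a + b = 0 := Multiset.eq_zero_of_forall_notMem h
      have h0 : a = 0 := by simp_all
      simp [h0] at hpos
    classical
    exact ⟨Nat.find hne, Nat.find_spec hne, fun x hx => Nat.find_min' hne hx⟩
  have hma : ∀ x ∈ a, s ≤ x := fun x hx => hmin x (by simp [hx])
  have hmb : ∀ x ∈ b, s ≤ x := fun x hx => hmin x (by simp [hx])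
  have hs : 0 < s := by
    rcases Multiset.mem_add.1 hsab with h | h
    · exact ha s h
    · exact hb s h
  have hgood' : ∀ h, (∀ x ∈ b, h ∣ x) → (∀ x ∈ a, h ∣ x) →
      h * (b.card + a.card) < b.sum + 2 * h := fun h h1 h2 => by
    rw [add_comm b.card, ← hsum]; exact hgood h h2 h1
  have hane : ∃ x, x ∈ a := by
    by_contra! h
    rw [Multiset.eq_zero_of_forall_notMem h] at hpos
    simp at hpos
  have hbne : ∃ x, x ∈ b := by
    by_contra! h
    rw [hsum, Multiset.eq_zero_of_forall_notMem h] at hpos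
    simp at hpos
  -- Unless all entries equal `s`, the minimum occurs on one side with a larger entry on the other,
  -- up to symmetry.
  by_cases hxa : ∃ x ∈ a, s < x
  · by_cases hsb : s ∈ b
    · exact (step (by omega) hmb hma hs hsb hsum.symm hxa hgood').symm
    · have hsa : s ∈ a := by
        rcases Multiset.mem_add.1 hsab with h | h
        · exact h
        · exact absurd h hsb
      obtain ⟨x, hx⟩ := hbne
      refine step hn hma hmb hs hsa hsum ⟨x, hx, lt_of_le_of_ne (hmb x hx) ?_⟩ hgood
      rintro rfl; exact hsb hx
  · push Not at hxa
    have haeq : ∀ x ∈ a, x = s := fun x hx => le_antisymm (hxa x hx) (hma x hx)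
    have hsa : s ∈ a := by
      obtain ⟨x, hx⟩ := hane
      exact haeq x hx ▸ hx
    by_cases hxb : ∃ x ∈ b, s < x
    · exact step hn hma hmb hs hsa hsum hxb hgood
    · push Not at hxb
      have hbeq : ∀ x ∈ b, x = s := fun x hx => le_antisymm (hxb x hx) (hmb x hx)
      -- When all entries equal `s`, the bound for the divisor `s` leaves only the single edge.
      have hg := hgood s (fun x hx => (haeq x hx) ▸ dvd_rfl) fun x hx => (hbeq x hx) ▸ dvd_rfl
      have ea := Multiset.eq_replicate_card.2 haeq
      have eb := Multiset.eq_replicate_card.2 hbeq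
      have sa : a.sum = a.card * s := by rw [ea]; simp
      have sb : b.sum = b.card * s := by rw [eb]; simp
      have hcard : a.card = b.card := by
        rw [sa, sb] at hsum; exact Nat.eq_of_mul_eq_mul_right hs hsum
      have hc0 : 0 < a.card := Multiset.card_pos_iff_exists_mem.2 hane
      have hc1 : a.card = 1 := by
        rw [sa, ← hcard] at hg
        by_contra hne
        have : 2 ≤ a.card := by omega
        nlinarith
      rw [ea, eb, ← hcard, hc1]
      simpa using IsWeightedTree.edge hs

/-! ### From trees to permutations. -/

namespace Equiv.Perm

theorem sameCycle_of_parts_eq_singleton {α : Type*} [Fintype α] [DecidableEq α] {τ : Perm α} {w : ℕ}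
    (h : τ.partition.parts = {w}) (x y : α) : τ.SameCycle x y := by
  have h1 := cycleLength_mem_parts τ x
  rw [h, Multiset.mem_singleton] at h1
  have h2 := sum_parts τ
  rw [h, Multiset.sum_singleton] at h2
  have : {y | τ.SameCycle x y} = _root_.Set.univ := by
    apply _root_.Set.eq_of_subset_of_ncard_le (_root_.Set.subset_univ _)
    rw [Set.ncard_univ, Nat.card_eq_fintype_card, ← h2]
    exact h1.ge
  exact (this ▸ _root_.Set.mem_univ y : y ∈ {y | τ.SameCycle x y})

/-- The predicate `P` is invariant under `τ`. -/
def Preserves {α : Type*} (τ : Perm α) (P : α → Prop) : Prop := ∀ x, P (τ x) ↔ P x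

theorem Preserves.mul {α : Type*} {σ τ : Perm α} {P : α → Prop} (hσ : σ.Preserves P)
    (hτ : τ.Preserves P) : (σ * τ).Preserves P := fun x => (hσ _).trans (hτ x)

theorem Preserves.inv {α : Type*} {σ : Perm α} {P : α → Prop} (hσ : σ.Preserves P) :
    σ⁻¹.Preserves P := fun x => by rw [← hσ, ← mul_apply, mul_inv_cancel, one_apply]

theorem preserves_inv_iff {α : Type*} {σ : Perm α} {P : α → Prop} :
    σ⁻¹.Preserves P ↔ σ.Preserves P := ⟨fun h => by simpa using h.inv, Preserves.inv⟩

theorem Preserves.apply_iff_of_sameCycle {α : Type*} {σ : Perm α} {P : α → Prop}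
    (hσ : σ.Preserves P) {x y : α} (h : σ.SameCycle x y) : P x ↔ P y := by
  have key : ∀ n : ℕ, (σ ^ n).Preserves P := by
    intro n
    induction n with
    | zero => intro x; rfl
    | succ n ih => rw [pow_succ]; exact ih.mul hσ
  obtain ⟨i, rfl⟩ := h
  obtain ⟨n, rfl | rfl⟩ := i.eq_nat_or_neg
  · rw [zpow_natCast]; exact (key n x).symm
  · rw [zpow_neg, zpow_natCast]; exact ((key n).inv x).symm

/-- The permutations of the list generate a transitive group: a predicate invariant under all of
them is constant. -/
def IsTransitiveList {α : Type*} (L : List (Perm α)) : Prop :=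
  ∀ P : α → Prop, (∀ τ ∈ L, τ.Preserves P) → ∀ x y, P x → P y

theorem isTransitiveList_cons_cons_iff {α : Type*} {τ₁ τ₂ : Perm α} {L : List (Perm α)} :
    IsTransitiveList (τ₁ :: τ₂ :: L) ↔ ∀ P : α → Prop, τ₁.Preserves P → τ₂.Preserves P →
      (∀ τ ∈ L, τ.Preserves P) → ∀ x y, P x → P y := by
  simp [IsTransitiveList]

theorem IsTransitiveList.isPretransitive {α : Type*} {L : List (Perm α)} (h : IsTransitiveList L)
    {S : Set (Perm α)} (hS : ∀ τ ∈ L, τ ∈ S) :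
    MulAction.IsPretransitive (Subgroup.closure S) α := by
  refine ⟨fun x y => ?_⟩
  -- The invariant predicate is membership in the orbit of `x`.
  refine h (fun z => ∃ g : Subgroup.closure S, g • x = z) (fun τ hτ z => ?_) x y ⟨1, one_smul _ _⟩
  let t : Subgroup.closure S := ⟨τ, Subgroup.subset_closure (hS τ hτ)⟩
  constructor
  · rintro ⟨g, hg⟩
    exact ⟨t⁻¹ * g, by rw [mul_smul, hg, inv_smul_eq_iff]; rfl⟩
  · rintro ⟨g, hg⟩
    exact ⟨t * g, by rw [mul_smul, hg]; rfl⟩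

/-- There is a transitive triple of permutations with product one whose first two members have
cycle types `a`, `b` and whose third one is a cycle of length `|a| + |b| - 1`. -/
def IsCycleRealizable (a b : Multiset ℕ) : Prop :=
  ∃ (α : Type) (_ : Fintype α) (_ : DecidableEq α) (τ₁ τ₂ σ : Perm α) (k j : ℕ),
    τ₁ * τ₂ * σ = 1 ∧ τ₁.partition.parts = a ∧ τ₂.partition.parts = b ∧
    σ.partition.parts = k ::ₘ Multiset.replicate j 1 ∧ k + 1 = a.card + b.card ∧
    IsTransitiveList [τ₁, τ₂, σ]

theorem IsCycleRealizable.symm {a b : Multiset ℕ} (h : IsCycleRealizable a b) :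
    IsCycleRealizable b a := by
  obtain ⟨α, _, _, τ₁, τ₂, σ, k, j, hprod, h1, h2, h3, hk, htr⟩ := h
  refine ⟨α, inferInstance, inferInstance, τ₂⁻¹, τ₁⁻¹, σ⁻¹, k, j, ?_, ?_, ?_, ?_, by omega, ?_⟩
  · have hσ : σ = (τ₁ * τ₂)⁻¹ := (inv_eq_of_mul_eq_one_right hprod).symm
    rw [hσ]; group
  · rw [parts_inv, h2]
  · rw [parts_inv, h1]
  · rw [parts_inv, h3]
  · rw [isTransitiveList_cons_cons_iff] at htr ⊢
    simp only [preserves_inv_iff, List.mem_singleton, forall_eq] at htr ⊢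
    exact fun P h1 h2 h3 => htr P h2 h1 h3

theorem isCycleRealizable_singleton {w : ℕ} (hw : 0 < w) : IsCycleRealizable {w} {w} := by
  -- One edge means a cycle of length `1`: the identity, with one fixed point counted as the cycle
  -- and `w - 1` others.
  refine ⟨Fin w, inferInstance, inferInstance, finRotate w, (finRotate w)⁻¹, 1, 1, w - 1, by simp,
    parts_finRotate hw, by rw [parts_inv, parts_finRotate hw], ?_, by simp, ?_⟩
  · rw [parts_one, Fintype.card_fin, ← Multiset.replicate_succ]
    congr 1; omega
  · intro P hP x y
    exact ((hP _ (by simp)).apply_iff_of_sameCycle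
      (sameCycle_of_parts_eq_singleton (parts_finRotate hw) x y)).1

/-- If the `τ₂`-cycle of `u` missed the long cycle, `σ` would fix it pointwise, so it would be
invariant under `τ₁ = (τ₂ * σ)⁻¹` too and hence be everything. -/
theorem exists_sameCycle_cycleLength_eq {α : Type*} [Fintype α] [DecidableEq α]
    {τ₁ τ₂ σ : Perm α} {k j : ℕ} (hprod : τ₁ * τ₂ * σ = 1)
    (hσ : σ.partition.parts = k ::ₘ Multiset.replicate j 1) (htr : IsTransitiveList [τ₁, τ₂, σ])
    (u : α) : ∃ v, τ₂.SameCycle u v ∧ σ.cycleLength v = k := by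
  by_contra! hne
  have hone : ∀ v, τ₂.SameCycle u v → σ.cycleLength v = 1 := by
    intro v hv
    have := cycleLength_mem_parts σ v
    rw [hσ, Multiset.mem_cons] at this
    exact Multiset.eq_of_mem_replicate (this.resolve_left (hne v hv))
  have hfix : ∀ v, τ₂.SameCycle u v → σ v = v := by
    intro v hv
    have h1 := hone v hv
    unfold cycleLength at h1
    obtain ⟨z, hz⟩ := _root_.Set.ncard_eq_one.1 h1
    have e1 : v ∈ {y | σ.SameCycle v y} := SameCycle.refl _ _
    have e2 : σ v ∈ {y | σ.SameCycle v y} := sameCycle_apply_right.2 (SameCycle.refl _ _)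
    rw [hz, _root_.Set.mem_singleton_iff] at e1 e2
    rw [e2, ← e1]
  have h2 : τ₂.Preserves (τ₂.SameCycle u) := fun x => sameCycle_apply_right
  have h3 : σ.Preserves (τ₂.SameCycle u) := by
    intro x
    constructor
    · intro h
      have := σ.injective (hfix _ h)
      rwa [this] at h
    · intro h; rwa [hfix x h]
  have h1 : τ₁.Preserves (τ₂.SameCycle u) := by
    have : τ₁ = (τ₂ * σ)⁻¹ := eq_inv_of_mul_eq_one_left (by rw [← mul_assoc]; exact hprod)
    rw [this]
    exact (h2.mul h3).inv
  have hall := htr (τ₂.SameCycle u) (by simp [h1, h2, h3]) u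
  obtain ⟨v, hv⟩ := exists_cycleLength_eq (ρ := σ) (k := k) (by rw [hσ]; simp)
  exact hne v (hall v (SameCycle.refl _ _)) hv

/-- Add a disjoint `w`-cycle to `τ₁` and its inverse to `τ₂`, then insert `s * s = 1` between the
last two factors. With `u` on both a `y`-cycle of `τ₂` and the long cycle of `σ`, the transposition
`s` lengthens the former by `w` and the latter by one. -/
theorem IsCycleRealizable.leaf {a b : Multiset ℕ} {w y : ℕ} (hw : 0 < w)
    (h : IsCycleRealizable a (y ::ₘ b)) : IsCycleRealizable (w ::ₘ a) ((y + w) ::ₘ b) := by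
  obtain ⟨α, _, _, τ₁, τ₂, σ, k, j, hprod, h1, h2, h3, hk, htr⟩ := h
  obtain ⟨u₀, hu₀⟩ := exists_cycleLength_eq (ρ := τ₂) (k := y) (by rw [h2]; simp)
  obtain ⟨u, hu₀u, hu⟩ := exists_sameCycle_cycleLength_eq hprod h3 htr u₀
  rw [cycleLength_eq_of_sameCycle hu₀u] at hu₀
  let c := finRotate w
  have hc : c.partition.parts = {w} := parts_finRotate hw
  let v : Fin w := ⟨0, hw⟩
  let s : Perm (α ⊕ Fin w) := swap (Sum.inl u) (Sum.inr v)
  have hns : ∀ (f : Perm α) (g : Perm (Fin w)),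
      ¬ (sumCongr f g).SameCycle (Sum.inl u) (Sum.inr v) := by
    intro f g h
    obtain ⟨z, hz, -⟩ := sameCycle_sumCongr_inl.1 h
    cases hz
  refine ⟨α ⊕ Fin w, inferInstance, inferInstance, sumCongr τ₁ c, sumCongr τ₂ c⁻¹ * s,
    s * sumCongr σ 1, k + 1, j + w - 1, ?_, ?_, ?_, ?_, ?_, ?_⟩
  · have hs : s * s = 1 := swap_mul_self _ _
    calc sumCongr τ₁ c * (sumCongr τ₂ c⁻¹ * s) * (s * sumCongr σ 1)
        = sumCongr τ₁ c * sumCongr τ₂ c⁻¹ * (s * s) * sumCongr σ 1 := by group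
      _ = sumCongr (τ₁ * τ₂ * σ) (c * c⁻¹ * 1) := by
        rw [hs, mul_one, sumCongr_mul, sumCongr_mul]
      _ = 1 := by rw [hprod]; simp
  · rw [parts_sumCongr, h1, hc, add_comm, Multiset.singleton_add]
  · have := parts_mul_swap (hns τ₂ c⁻¹)
    have hcv : (c⁻¹).cycleLength v = w := by
      have := cycleLength_mem_parts c⁻¹ v
      rwa [parts_inv, hc, Multiset.mem_singleton] at this
    rw [cycleLength_sumCongr_inl, cycleLength_sumCongr_inr, hu₀, hcv, parts_sumCongr, parts_inv, hc,
      h2] at this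
    refine add_right_cancel (b := {y, w}) (this.trans ?_)
    simp only [← Multiset.singleton_add, Multiset.insert_eq_cons]
    abel
  · have := parts_swap_mul (hns σ 1)
    have hcv : (1 : Perm (Fin w)).cycleLength v = 1 := by
      have := cycleLength_mem_parts (1 : Perm (Fin w)) v
      rw [parts_one] at this
      exact Multiset.eq_of_mem_replicate this
    rw [cycleLength_sumCongr_inl, cycleLength_sumCongr_inr, hu, hcv, parts_sumCongr, parts_one,
      h3, Fintype.card_fin] at this
    refine add_right_cancel (b := {k, 1}) (this.trans ?_)
    obtain ⟨w, rfl⟩ := Nat.exists_eq_add_of_lt hw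
    rw [show j + (0 + w + 1) - 1 = j + w by omega, Multiset.replicate_add, Multiset.replicate_add,
      Multiset.replicate_add]
    simp only [← Multiset.singleton_add, Multiset.insert_eq_cons, Multiset.replicate_one,
      Multiset.replicate_zero]
    abel
  · simp at hk ⊢; omega
  · rw [isTransitiveList_cons_cons_iff] at htr ⊢
    intro P p1 p2 p3
    have p3 := p3 (s * sumCongr σ 1) (by simp)
    have hPu : P (Sum.inl u) ↔ P (Sum.inr v) := by
      -- The modified `τ₂` agrees with the old one on `α` except at `u`; counting supplies the
      -- missing point.
      have e : P (Sum.inl (τ₂ u)) ↔ P (Sum.inl u) := by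
        refine apply_iff_of_forall_ne (f := τ₂) (P := fun x => P (Sum.inl x)) fun x hx => ?_
        have := p2 (Sum.inl x)
        rwa [mul_apply, swap_apply_of_ne_of_ne (by simpa using hx) (by simp)] at this
      have := p2 (Sum.inr v)
      rw [mul_apply, swap_apply_right] at this
      exact e.symm.trans this
    have ps : s.Preserves P := by
      intro x
      by_cases h1 : x = Sum.inl u
      · rw [h1, swap_apply_left, hPu]
      by_cases h2 : x = Sum.inr v
      · rw [h2, swap_apply_right, hPu]
      rw [swap_apply_of_ne_of_ne h1 h2]
    have q2 : (sumCongr τ₂ c⁻¹).Preserves P := by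
      have := p2.mul ps
      rwa [mul_assoc, swap_mul_self, mul_one] at this
    have q3 : (sumCongr σ (1 : Perm (Fin w))).Preserves P := by
      have := ps.mul p3
      rwa [← mul_assoc, swap_mul_self, one_mul] at this
    have hl := htr (fun x => P (Sum.inl x)) (fun x => p1 (Sum.inl x)) (fun x => q2 (Sum.inl x))
      (List.forall_mem_singleton.2 fun x => q3 (Sum.inl x))
    have hr : ∀ x y, P (Sum.inr x) ↔ P (Sum.inr y) := fun x y =>
      Preserves.apply_iff_of_sameCycle (P := fun x => P (Sum.inr x)) (fun x => p1 (Sum.inr x))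
        (sameCycle_of_parts_eq_singleton hc x y)
    have hall : ∀ z, P z ↔ P (Sum.inr v) := by
      rintro (z | z)
      · rw [← hPu]; exact ⟨hl z u, hl u z⟩
      · exact hr z v
    exact fun x y hx => (hall y).2 ((hall x).1 hx)

theorem _root_.IsWeightedTree.isCycleRealizable {a b : Multiset ℕ} (h : IsWeightedTree a b) :
    IsCycleRealizable a b := by
  induction h with
  | edge hw => exact isCycleRealizable_singleton hw
  | leaf hw _ ih => exact ih.leaf hw
  | symm _ ih => exact ih.symm

end Equiv.Perm

/-! ### Several cycles: Hurwitz moves, splitting and induction. -/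

namespace Equiv.Perm

theorem parts_conj {α : Type*} [Fintype α] [DecidableEq α] (g σ : Perm α) :
    (g * σ * g⁻¹).partition.parts = σ.partition.parts := by
  rw [(partition_eq_of_isConj.1 (isConj_iff.2 ⟨g, rfl⟩) : σ.partition = (g * σ * g⁻¹).partition)]

/-- `σ` is a cycle of length `m + 1`. -/
def IsCycleOfLengthSucc {α : Type*} [Fintype α] [DecidableEq α] (σ : Perm α) (m : ℕ) : Prop :=
  ∃ j, σ.partition.parts = (m + 1) ::ₘ Multiset.replicate j 1

/-- Hurwitz moves rearrange the cycle types of the factors of a product. -/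
theorem exists_forall₂_isCycleOfLengthSucc_of_perm {α : Type*} [Fintype α] [DecidableEq α]
    {ms ms' : List ℕ} (h : ms.Perm ms') : ∀ L : List (Perm α),
    List.Forall₂ IsCycleOfLengthSucc L ms → ∃ L' : List (Perm α),
      List.Forall₂ IsCycleOfLengthSucc L' ms' ∧ L'.prod = L.prod ∧
      ∀ P : α → Prop, (∀ σ ∈ L', σ.Preserves P) → ∀ σ ∈ L, σ.Preserves P := by
  induction h with
  | nil => exact fun L hL => ⟨L, hL, rfl, fun _ h => h⟩
  | cons m _ ih =>
    intro L₀ hL₀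
    obtain ⟨σ, L, hσ, hL, rfl⟩ := List.forall₂_cons_right_iff.1 hL₀
    obtain ⟨L', h1, h2, h3⟩ := ih L hL
    refine ⟨σ :: L', .cons hσ h1, by simp [h2], fun P hP => ?_⟩
    rw [List.forall_mem_cons] at hP ⊢
    exact ⟨hP.1, h3 P hP.2⟩
  | swap m m' ms =>
    intro L₀ hL₀
    obtain ⟨σ, L₁, hσ, hL₁, rfl⟩ := List.forall₂_cons_right_iff.1 hL₀
    obtain ⟨τ, L, hτ, hL, rfl⟩ := List.forall₂_cons_right_iff.1 hL₁
    -- The Hurwitz move `(σ, τ) ↦ (σ * τ * σ⁻¹, σ)` keeps the product and the generated group.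
    refine ⟨(σ * τ * σ⁻¹) :: σ :: L, .cons ?_ (.cons hσ hL), by simp [mul_assoc], fun P hP => ?_⟩
    · obtain ⟨j, hj⟩ := hτ
      exact ⟨j, by rw [parts_conj, hj]⟩
    · rw [List.forall_mem_cons, List.forall_mem_cons] at hP ⊢
      obtain ⟨h1, h2, h3⟩ := hP
      refine ⟨h2, ?_, h3⟩
      have := (h2.inv.mul h1).mul h2
      simpa [mul_assoc] using this
  | trans _ _ ih ih' =>
    intro L hL
    obtain ⟨L', h1, h2, h3⟩ := ih L hL
    obtain ⟨L'', h1', h2', h3'⟩ := ih' L' h1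
    exact ⟨L'', h1', h2'.trans h2, fun P hP => h3 P (h3' P hP)⟩

/-- There are transitive permutations with product one, of which the first two have cycle types `a`
and `b` and the others are cycles of lengths `m + 1` for `m` in `ms`. -/
def IsRealizable (a b : Multiset ℕ) (ms : List ℕ) : Prop :=
  ∃ (α : Type) (_ : Fintype α) (_ : DecidableEq α) (τ₁ τ₂ : Perm α) (L : List (Perm α)),
    τ₁ * τ₂ * L.prod = 1 ∧ τ₁.partition.parts = a ∧ τ₂.partition.parts = b ∧
    List.Forall₂ IsCycleOfLengthSucc L ms ∧ IsTransitiveList (τ₁ :: τ₂ :: L)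

variable {a b U B : Multiset ℕ} {ms ms' : List ℕ} {m : ℕ}

theorem IsRealizable.perm (h : IsRealizable a b ms) (hms : ms.Perm ms') :
    IsRealizable a b ms' := by
  obtain ⟨α, _, _, τ₁, τ₂, L, hprod, h1, h2, hL, htr⟩ := h
  obtain ⟨L', hL', hp, hP⟩ := exists_forall₂_isCycleOfLengthSucc_of_perm hms L hL
  refine ⟨α, inferInstance, inferInstance, τ₁, τ₂, L', by rw [hp, hprod], h1, h2, hL', ?_⟩
  rw [isTransitiveList_cons_cons_iff] at htr ⊢
  exact fun P q1 q2 q3 => htr P q1 q2 (hP P q3)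

theorem IsRealizable.symm (h : IsRealizable a b ms) : IsRealizable b a ms := by
  obtain ⟨α, _, _, τ₁, τ₂, L, hprod, h1, h2, hL, htr⟩ := h
  -- Inversion reverses the order of the factors, which Hurwitz moves undo.
  refine IsRealizable.perm (ms := ms.reverse) ⟨α, inferInstance, inferInstance, τ₂⁻¹, τ₁⁻¹,
    (L.map (·⁻¹)).reverse, ?_, ?_, ?_, ?_, ?_⟩ ms.reverse_perm
  · rw [← List.prod_inv_reverse, (inv_eq_of_mul_eq_one_right hprod).symm]; group
  · rw [parts_inv, h2]
  · rw [parts_inv, h1]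
  · rw [List.forall₂_reverse_iff, List.forall₂_map_left_iff]
    refine hL.imp fun σ m ⟨j, hj⟩ => ⟨j, by rw [parts_inv, hj]⟩
  · rw [isTransitiveList_cons_cons_iff] at htr ⊢
    simp only [preserves_inv_iff, List.mem_reverse, List.mem_map, forall_exists_index, and_imp,
      forall_apply_eq_imp_iff₂]
    exact fun P h1 h2 h3 => htr P h2 h1 h3

theorem IsCycleRealizable.isRealizable (h : IsCycleRealizable a b) (hm : m + 2 = a.card + b.card) :
    IsRealizable a b [m] := by
  obtain ⟨α, _, _, τ₁, τ₂, σ, k, j, hprod, h1, h2, h3, hk, htr⟩ := h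
  obtain rfl : k = m + 1 := by omega
  exact ⟨α, inferInstance, inferInstance, τ₁, τ₂, [σ], by simpa using hprod, h1, h2,
    .cons ⟨j, h3⟩ .nil, htr⟩

/-- In `ρ₁ * ρ₂ * σ = 1` the `x`-cycle `ρ₁⁻¹` equals `ρ₂ * σ`. Substitute this for the `x`-cycle of
`τ₂`; a predicate invariant under both factors is invariant under `τ₂`, so transitivity survives. -/
theorem IsRealizable.split {x : ℕ} (h : IsRealizable a (x ::ₘ U) ms)
    (hB : IsCycleRealizable {x} B) (hm : B.card = m + 1) : IsRealizable a (B + U) (m :: ms) := by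
  obtain ⟨α, _, _, τ₁, τ₂, L, hprod, h1, h2, hL, htr⟩ := h
  obtain ⟨β, _, _, ρ₁, ρ₂, σ, k, j, hprod', h1', h2', h3', hk, -⟩ := hB
  obtain rfl : k = m + 1 := by simp at hk; omega
  obtain ⟨γ, _, _, υ, hυ⟩ := exists_perm_parts U fun y hy =>
    τ₂.partition.parts_pos (by rw [h2]; exact Multiset.mem_cons_of_mem hy)
  obtain ⟨e, he⟩ := exists_permCongr_eq (σ := sumCongr ρ₁⁻¹ υ) (τ := τ₂) (by
    rw [parts_sumCongr, parts_inv, h1', hυ, h2, Multiset.singleton_add])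
  have hρ : ρ₁⁻¹ = ρ₂ * σ := inv_eq_of_mul_eq_one_right (by rw [← mul_assoc]; exact hprod')
  have hτ : τ₂ = e.permCongr (sumCongr ρ₂ υ) * e.permCongr (sumCongr σ 1) := by
    rw [← he, hρ, ← permCongr_mul, sumCongr_mul, mul_one]
  refine ⟨α, inferInstance, inferInstance, τ₁, e.permCongr (sumCongr ρ₂ υ),
    e.permCongr (sumCongr σ 1) :: L, ?_, h1, ?_, .cons ⟨j + Fintype.card γ, ?_⟩ hL, ?_⟩
  · rw [← hprod, hτ, List.prod_cons]; simp only [mul_assoc]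
  · rw [parts_permCongr, parts_sumCongr, h2', hυ]
  · rw [parts_permCongr, parts_sumCongr, h3', parts_one, Multiset.replicate_add, Multiset.cons_add]
  · rw [isTransitiveList_cons_cons_iff] at htr ⊢
    intro P q1 q2 q3
    rw [List.forall_mem_cons] at q3
    exact htr P q1 (hτ ▸ q2.mul q3.1) q3.2

theorem isRealizable_of_forall_dvd (ha : ∀ x ∈ a, 0 < x) (hb : ∀ x ∈ b, 0 < x)
    (hsum : a.sum = b.sum) (hpos : 0 < a.sum) (hne : ms ≠ []) (hms : ms.sum + 2 = a.card + b.card)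
    (hgood : ∀ k ∈ ms, ∀ h, (∀ x ∈ a, h ∣ x) → (∀ x ∈ b, h ∣ x) → h * k < a.sum) :
    IsRealizable a b ms := by
  induction hn : ms.length using Nat.strong_induction_on generalizing a b ms with
  | _ n ih =>
  have step : ∀ {a b : Multiset ℕ} {m : ℕ} {rest : List ℕ}, rest.length < n →
      (∀ x ∈ a, 0 < x) → (∀ x ∈ b, 0 < x) → a.sum = b.sum → 0 < a.sum → rest ≠ [] →
      (m :: rest).sum + 2 = a.card + b.card → m + 1 ≤ b.card →
      (∀ k ∈ rest, ∀ h, (∀ x ∈ a, h ∣ x) → (∀ x ∈ b, h ∣ x) → h * k < a.sum) →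
      IsRealizable a b (m :: rest) := by
    intro a b m rest hlen ha hb hsum hpos hne hms hm hgood
    rw [List.sum_cons] at hms
    obtain ⟨B, U, rfl, hBc, hgood'⟩ := Multiset.exists_merge ha hb hsum hpos hm
      (K := {k | k ∈ rest}) (fun k hk => by
        have := List.le_sum_of_mem hk; omega) hgood
    have hB0 : ∀ x ∈ B, 0 < x := fun x hx => hb x (by simp [hx])
    have hBcard := Multiset.mul_card_le_sum hB0 (n := 1) (by simp)
    have hBpos : 0 < B.sum := by omega
    rw [Multiset.card_add] at hms
    refine IsRealizable.split (x := B.sum) (ih _ hlen ha ?_ ?_ hpos hne ?_ hgood' rfl) ?_ hBc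
    · intro x hx
      rcases Multiset.mem_cons.1 hx with rfl | hx
      · exact hBpos
      · exact hb x (by simp [hx])
    · rw [hsum]; simp
    · simp; omega
    -- A tree with one vertex on one side is a star, and the divisor bound reduces to `h * B.card ≤
    -- B.sum`.
    · refine (isWeightedTree_of_forall_dvd (by simpa using hBpos) hB0 (by simp)
        (by simpa using hBpos) fun h _ h2 => ?_).isCycleRealizable
      have h3 := Multiset.mul_card_le_sum hB0 h2
      have h0 : 0 < h := by
        obtain ⟨x, hx⟩ := Multiset.card_pos_iff_exists_mem.1 (by omega : 0 < B.card)
        exact Nat.pos_of_dvd_of_pos (h2 x hx) (hB0 x hx)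
      simp only [Multiset.card_singleton, Multiset.sum_singleton]
      nlinarith
  match ms, hne with
  | [m], _ =>
    refine (isWeightedTree_of_forall_dvd ha hb hsum hpos fun h h1 h2 => ?_).isCycleRealizable
      |>.isRealizable (by simpa using hms)
    have := hgood m (by simp) h h1 h2
    have e : a.card + b.card = m + 2 := by simpa using hms.symm
    rw [e]; linarith
  | x :: y :: rest, _ =>
    -- `m` is a part with `2 * m` at most the sum of all parts
    obtain ⟨m, rest', hperm, hm⟩ : ∃ m rest', (m :: rest').Perm (x :: y :: rest) ∧
        2 * m ≤ (x :: y :: rest).sum := by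
      rcases le_total x y with h | h
      · exact ⟨x, y :: rest, List.Perm.refl _, by simp; omega⟩
      · exact ⟨y, x :: rest, List.Perm.swap _ _ _, by simp; omega⟩
    have hlen : rest'.length < n := by
      have := hperm.length_eq
      rw [hn, List.length_cons] at this; omega
    have hne' : rest' ≠ [] := by
      rintro rfl
      have := hperm.length_eq
      simp at this
    have hms' : (m :: rest').sum + 2 = a.card + b.card := by rw [hperm.sum_eq, hms]
    have hgood' : ∀ k ∈ rest', ∀ h, (∀ x ∈ a, h ∣ x) → (∀ x ∈ b, h ∣ x) → h * k < a.sum :=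
      fun k hk => hgood k (hperm.subset (List.mem_cons_of_mem _ hk))
    refine IsRealizable.perm ?_ hperm
    -- Since `2 * m + 2 ≤ a.card + b.card`, one of the two cardinalities is at least `m + 1`.
    rcases le_or_gt (m + 1) b.card with hmb | hmb
    · exact step hlen ha hb hsum hpos hne' hms' hmb hgood'
    · refine (step hlen hb ha hsum.symm (hsum ▸ hpos) hne' (by omega) (by omega) ?_).symm
      exact fun k hk h h1 h2 => hsum ▸ hgood' k hk h h2 h1

theorem IsRealizable.exists_fin {l : ℕ} {m : Fin l → ℕ} {d : ℕ}
    (h : IsRealizable a b (List.ofFn m)) (hd : a.sum = d) :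
    ∃ (τ₁ τ₂ : Perm (Fin d)) (σ : Fin l → Perm (Fin d)), τ₁ * τ₂ * (List.ofFn σ).prod = 1 ∧
      τ₁.partition.parts = a ∧ τ₂.partition.parts = b ∧ (∀ k, IsCycleOfLengthSucc (σ k) (m k)) ∧
      IsTransitiveList (τ₁ :: τ₂ :: List.ofFn σ) := by
  obtain ⟨α, _, _, τ₁, τ₂, L, hprod, h1, h2, hL, htr⟩ := h
  have hcard : Fintype.card α = Fintype.card (Fin d) := by
    rw [← sum_parts τ₁, h1, hd, Fintype.card_fin]
  let e := Fintype.equivOfCardEq hcard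
  obtain ⟨hlen, hget⟩ := List.forall₂_iff_get.1 hL
  rw [List.length_ofFn] at hlen
  subst hlen
  have hof : List.ofFn (fun k => e.permCongrHom (L.get k)) = L.map e.permCongrHom := by
    conv_rhs => rw [← List.ofFn_get L, List.map_ofFn]
    rfl
  refine ⟨e.permCongrHom τ₁, e.permCongrHom τ₂, fun k => e.permCongrHom (L.get k), ?_, ?_, ?_, ?_,
    ?_⟩
  · rw [hof, ← map_list_prod, ← map_mul, ← map_mul, hprod, map_one]
  · exact (parts_permCongr e τ₁).trans h1
  · exact (parts_permCongr e τ₂).trans h2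
  · intro k
    obtain ⟨j, hj⟩ := hget k k.2 (by simp)
    refine ⟨j, (parts_permCongr e _).trans ?_⟩
    simpa using hj
  · rw [hof]
    intro P hP x y hx
    have hpre : ∀ τ : Perm α, (e.permCongrHom τ).Preserves P → τ.Preserves fun z => P (e z) := by
      intro τ h z
      have := h (e z)
      simpa [Equiv.permCongr_apply] using this
    have := htr (fun z => P (e z)) (fun τ hτ => hpre τ (hP _ (by
      have := List.mem_map_of_mem (f := e.permCongrHom) hτ
      simpa using this))) (e.symm x) (e.symm y)
    simpa [hx] using this

end Equiv.Perm

/-! ### The degree hypothesis and the conclusion. -/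

/-- A common divisor `h` is at most the gcd `g`, and the degree hypothesis says `partitionWeight m *
g < d`. -/
theorem partitionWeight_mul_lt {d l p q : ℕ} {a : Fin p → ℕ} {b : Fin q → ℕ} {m : Fin l → ℕ}
    (hd : 0 < d) (hasum : ∑ i, a i = d)
    (ha : ∀ i, 0 < a i)
    (hdeg : (partitionWeight m : ℚ) < residueDegree (residueVector a b)) (k : Fin l) {h : ℕ}
    (h1 : ∀ i, h ∣ a i) (h2 : ∀ j, h ∣ b j) : h * m k < d := by
  have hsum : (∑ j with 0 < residueVector a b j, residueVector a b j) = (d : ℤ) := by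
    rw [Finset.sum_filter, Fintype.sum_sum_type, ← hasum]
    have hb0 : ∀ j, ¬ (b j : ℤ) < 0 := fun j => by omega
    simp [residueVector, ha, hb0]
  set g : ℤ := Finset.univ.gcd (residueVector a b) with hg
  have hdvd : (h : ℤ) ∣ g := by
    refine Finset.dvd_gcd fun j _ => ?_
    rcases j with i | j
    · exact Int.natCast_dvd_natCast.2 (h1 i)
    · exact (dvd_neg).2 (Int.natCast_dvd_natCast.2 (h2 j))
  have hg0 : 0 < g := by
    have hnn : 0 ≤ g := Int.nonneg_of_normalize_eq_self Finset.normalize_gcd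
    refine lt_of_le_of_ne hnn fun h0 => hd.ne ?_
    rw [← hasum, eq_comm, Finset.sum_eq_zero fun i _ => ?_]
    have := Finset.gcd_eq_zero_iff.1 h0.symm (Sum.inl i) (Finset.mem_univ _)
    simpa [residueVector] using this
  have hle : (h : ℤ) ≤ g := Int.le_of_dvd hg0 hdvd
  have hmk : m k ≤ partitionWeight m := Finset.le_sup (f := m) (Finset.mem_univ k)
  unfold residueDegree at hdeg
  rw [hsum, ← hg, lt_div_iff₀ (by exact_mod_cast hg0)] at hdeg
  have h3 : (partitionWeight m : ℤ) * g < d := by exact_mod_cast hdeg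
  zify
  calc (h : ℤ) * m k ≤ g * partitionWeight m := by
        apply mul_le_mul hle (by exact_mod_cast hmk) (by positivity) hg0.le
    _ < d := by linarith

theorem theorem2p3 (d l p q : ℕ) (hd : 0 < d) (hl : 0 < l)
    (a : Fin p → ℕ) (b : Fin q → ℕ) (m : Fin l → ℕ)
    (ha : ∀ i, 0 < a i) (hb : ∀ j, 0 < b j) (hm : ∀ k, 0 < m k)
    (hasum : ∑ i, a i = d) (hbsum : ∑ j, b j = d) (hmsum : (∑ k, m k) + 2 = p + q)
    (hdeg : (partitionWeight m : ℚ) < residueDegree (residueVector a b)) :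
    ∃ (τ₁ τ₂ : Equiv.Perm (Fin d)) (σ : Fin l → Equiv.Perm (Fin d)),
      τ₁ * τ₂ * (List.ofFn σ).prod = 1 ∧
      HasType τ₁ (Finset.univ.val.map a) ∧
      HasType τ₂ (Finset.univ.val.map b) ∧
      (∀ k, HasType (σ k) ((1 + m k) ::ₘ Multiset.replicate (d - m k - 1) 1)) ∧
      MulAction.IsPretransitive
        (Subgroup.closure ({τ₁, τ₂} ∪ Set.range σ)) (Fin d) := by
  have hsa : (Finset.univ.val.map a).sum = d := hasum
  have hsb : (Finset.univ.val.map b).sum = d := hbsum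
  have hreal : Equiv.Perm.IsRealizable (Finset.univ.val.map a) (Finset.univ.val.map b)
      (List.ofFn m) := by
    refine Equiv.Perm.isRealizable_of_forall_dvd (by simpa using ha) (by simpa using hb)
      (hsa.trans hsb.symm) (hsa ▸ hd) ?_ ?_ ?_
    · intro h
      have := congrArg List.length h
      simp at this; omega
    · simpa [List.sum_ofFn] using hmsum
    · intro k hk h h1 h2
      obtain ⟨i, rfl⟩ := (List.mem_ofFn' m k).1 hk
      rw [hsa]
      exact partitionWeight_mul_lt hd hasum ha hdeg i (by simpa using h1) (by simpa using h2)
  obtain ⟨τ₁, τ₂, σ, hprod, h1, h2, h3, htr⟩ := hreal.exists_fin hsa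
  refine ⟨τ₁, τ₂, σ, hprod, h1, h2, fun k => ?_, htr.isPretransitive ?_⟩
  · obtain ⟨j, hj⟩ := h3 k
    have hs := Equiv.Perm.sum_parts (σ k)
    rw [hj, Fintype.card_fin] at hs
    simp at hs
    rw [HasType, hj, add_comm 1, show d - m k - 1 = j by omega]
  · intro τ hτ
    simp only [List.mem_cons, List.mem_ofFn'] at hτ
    rcases hτ with rfl | rfl | hτ
    · simp
    · simp
    · exact Or.inr hτ
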